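/- **Clustered microgrid stability.** Consider a DC microgrid whose buses are partitioned into $M$ clusters. Cluster $m$ has a finite set $\mathcal S_m$ of voltage setting buses, a finite set $\mathcal F_m$ of voltage following buses, $\mathcal N_m=\mathcal S_m\cup\mathcal F_m$, and a finite set $\mathcal E_m$ of directed lines between buses of $\mathcal N_m$; a further finite set $\mathcal T$ of directed lines joins buses of arbitrary clusters. Bus $n$ has filter inductance, resistance and capacitance $L_n,R_n,C_n>0$; line $l$ has $\pi$-model parameters $L_l,R_l,C_l>0$. Put $C^{\rm eq}_n=C_n+\sum_{l}\tfrac12C_l$ (sum over all lines of $\mathcal E_m\cup\mathcal T$ ending at $n$). The load current $i_{L,n}:\mathbb R\to\mathbb R$ at bus $n$ is a static, globally Lipschitz function of the bus voltage, and $Y_n\in\mathbb R$ is such that $i_{LP,n}(v)=i_{L,n}(v)+Y_nv$ is monotone increasing. Let $E_m=(e_{nl})$ be the incidence matrix of cluster $m$ ($+1$ at the sink of a line, $-1$ at its source). Voltage setting buses $j$ have setpoints $v^*_j\ge 0$ and gains $\omega_j,\psi^V_j,\psi^I_j,\delta_j>0$; voltage following buses $k$ have gains $\alpha_k,\beta_k,\tau_k,\delta_k>0$.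 Put $$\hat\psi^I_j=\psi^I_j+R_j,\quad \hat\psi^V_j=\psi^V_j+1-\delta_j\hat\psi^I_j,\quad \hat\omega_j=L_j\omega_j,\quad \hat\beta_k=R_k+\beta_k,\quad \hat\alpha_k=\alpha_k-\hat\beta_k\delta_k .$$ *Equilibrium assumption.* There are constant filter currents $\bar i_n$, bus voltages $\bar v_n\ge 0$, converter voltages $\bar v^{\rm VSC}_n$ and line currents $\bar i_l$, with $\bar v_j=v^*_j$ for $j\in\mathcal S_m$ and $\bar i_k=0$ for $k\in\mathcal F_m$, at which the uncontrolled microgrid is at rest: for every $n\in\mathcal N_m$, $$-R_n\bar i_n-\bar v_n+\bar v^{\rm VSC}_n=0,\qquad \bar i_n+Y_n\bar v_n+\sum_{l\in\mathcal E_m}e_{nl}\bar i_l+\bar i^{\rm ex}_n=0,$$ where $\bar i^{\rm ex}_n$ is the net steady-state current of the lines in $\mathcal T$ into bus $n$ minus $i_{LP,n}(\bar v_n)$, and $-R_l\bar i_l+\bar v_{\rm source(l)}-\bar v_{\rm sink(l)}=0$ for every line $l$. *Shifted closed-loop dynamics.* The error state of cluster $m$ is $\tilde x_m=(\tilde z_S,\tilde\imath^a_S,\tilde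 v_S,\tilde z_F,\tilde\imath^a_F,\tilde v_F,\tilde\imath_E)$ (integrator states $z$, currents $i^a=i+\delta v$, voltages $v$, line currents). Its dynamics are $Q_m\dot{\tilde x}_m=A_m\tilde x_m+B_m\tilde u_m$, $\tilde y_m=B_m^{\mathsf T}\tilde x_m=(\tilde v_S,\tilde v_F)$, with $Q_m={\rm diag}(L_S,L_S,C^{\rm eq}_S,I,L_F,C^{\rm eq}_F,L_E)$, $$A_m=\begin{bmatrix}0&0&\hat\omega&0&0&0&0\\-I&-\hat\psi^I&-\hat\psi^V&0&0&0&0\\0&I&Y_S-\delta_S&0&0&0&E_S\\0&0&0&-\tau&0&\tau\alpha&0\\0&0&0&I&-\hat\beta&-\hat\alpha&0\\0&0&0&0&I&Y_F-\delta_F&E_F\\0&0&-E_S^{\mathsf T}&0&0&-E_F^{\mathsf T}&-R_E\end{bmatrix},\qquad B_m=\begin{bmatrix}0&0\\0&0\\I&0\\0&0\\0&0\\0&I\\0&0\end{bmatrix},$$ where parameters denote the corresponding diagonal matrices. The clusters are interconnected by letting the component of $\tilde u_m$ at bus $n$ be the net error current of the lines in $\mathcal T$ into $n$ minus the shifted load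 $i_{LP,n}(\tilde v_n+\bar v_n)-i_{LP,n}(\bar v_n)$, and by $L_l\dot{\tilde\imath}_l=-R_l\tilde\imath_l+\tilde v_{\rm source(l)}-\tilde v_{\rm sink(l)}$ for $l\in\mathcal T$. *Theorem.* Let the equilibrium assumption hold, and suppose that for every cluster $m$ there are a symmetric positive definite matrix $P_m$ and an $\varepsilon>0$ with $$Q_mP_mA_m+A_m^{\mathsf T}P_mQ_m+\varepsilon B_mB_m^{\mathsf T}\preceq0,\qquad Q_mP_mB_m=B_m .$$ Then the equilibrium $\tilde x_m=0$, $\tilde u_m=0$ ($m=1,\dots,M$), $\tilde\imath_l=0$ ($l\in\mathcal T$) of the interconnected microgrid is asymptotically stable: solutions exist for all $t\ge0$ from all initial states near it, it is Lyapunov stable, and all solutions starting close enough to it converge to it. -/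

import Mathlib

open Filter Topology

noncomputable section

/-! ### Asymptotic stability of an equilibrium of an autonomous differential equation -/

/-- `x` solves `x' = f x` on `[0, ∞)`. -/
def IsSolution {X : Type*} [NormedAddCommGroup X] [NormedSpace ℝ X]
    (f : X → X) (x : ℝ → X) : Prop :=
  ∀ t : ℝ, 0 ≤ t → HasDerivWithinAt x (f (x t)) (Set.Ici 0) t

/-- `xeq` is an asymptotically stable equilibrium of `x' = f x`: it is an equilibrium, solutions
exist for all forward time from every nearby initial state, it is stable in the sense of Lyapunov,
and all solutions that start close enough converge to it. -/
structure IsAsymptoticallyStable {X : Type*} [NormedAddCommGroup X] [NormedSpace ℝ X]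
    (f : X → X) (xeq : X) : Prop where
  equilibrium : f xeq = 0
  exists_solution : ∃ r > 0, ∀ x₀ : X, ‖x₀ - xeq‖ < r → ∃ x : ℝ → X, IsSolution f x ∧ x 0 = x₀
  stable : ∀ ε > 0, ∃ r > 0, ∀ x : ℝ → X, IsSolution f x → ‖x 0 - xeq‖ < r →
    ∀ t : ℝ, 0 ≤ t → ‖x t - xeq‖ < ε
  attractive : ∃ r > 0, ∀ x : ℝ → X, IsSolution f x → ‖x 0 - xeq‖ < r →
    Tendsto x atTop (𝓝 xeq)

/-! ### The microgrid -/

/-- The data of a clustered DC microgrid with `M` clusters. The buses of cluster `m` are indexed by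
`Fin (nS m) ⊕ Fin (nF m)`: voltage setting buses on the left, voltage following buses on the
right. Every line has an arbitrary direction, from its source to its sink. -/
structure Microgrid where
  /-- number of clusters -/
  M : ℕ
  /-- number of voltage setting buses of each cluster -/
  nS : Fin M → ℕ
  /-- number of voltage following buses of each cluster -/
  nF : Fin M → ℕ
  /-- number of lines that belong to each cluster -/
  nE : Fin M → ℕ
  /-- number of lines that belong to no cluster -/
  nT : ℕ
  /-- source and sink of the lines inside a cluster -/
  srcE : ∀ m, Fin (nE m) → Fin (nS m) ⊕ Fin (nF m)
  snkE : ∀ m, Fin (nE m) → Fin (nS m) ⊕ Fin (nF m)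
  /-- source and sink of the lines that belong to no cluster -/
  srcT : Fin nT → Σ m, Fin (nS m) ⊕ Fin (nF m)
  snkT : Fin nT → Σ m, Fin (nS m) ⊕ Fin (nF m)
  /-- filter inductance, resistance and capacitance of each bus -/
  L : ∀ m, Fin (nS m) ⊕ Fin (nF m) → ℝ
  R : ∀ m, Fin (nS m) ⊕ Fin (nF m) → ℝ
  C : ∀ m, Fin (nS m) ⊕ Fin (nF m) → ℝ
  L_pos : ∀ m n, 0 < L m n
  R_pos : ∀ m n, 0 < R m n
  C_pos : ∀ m n, 0 < C m n
  /-- inductance, resistance and capacitance of the π-model of each line inside a cluster -/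
  LE : ∀ m, Fin (nE m) → ℝ
  RE : ∀ m, Fin (nE m) → ℝ
  CE : ∀ m, Fin (nE m) → ℝ
  LE_pos : ∀ m l, 0 < LE m l
  RE_pos : ∀ m l, 0 < RE m l
  CE_pos : ∀ m l, 0 < CE m l
  /-- inductance, resistance and capacitance of the π-model of each remaining line -/
  LT : Fin nT → ℝ
  RT : Fin nT → ℝ
  CT : Fin nT → ℝ
  LT_pos : ∀ l, 0 < LT l
  RT_pos : ∀ l, 0 < RT l
  CT_pos : ∀ l, 0 < CT l
  /-- static load current of each bus, as a function of the bus voltage -/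
  load : ∀ m, Fin (nS m) ⊕ Fin (nF m) → ℝ → ℝ
  load_lipschitz : ∀ m n, ∃ K : NNReal, LipschitzWith K (load m n)
  /-- gradient `Y` for which the load splits as (monotone part) `- Y * v` -/
  Y : ∀ m, Fin (nS m) ⊕ Fin (nF m) → ℝ
  monotone_load_add : ∀ m n, Monotone fun v : ℝ => load m n v + Y m n * v
  /-- damping gain on the capacitor current, of both controllers -/
  δ : ∀ m, Fin (nS m) ⊕ Fin (nF m) → ℝ
  δ_pos : ∀ m n, 0 < δ m n
  /-- voltage setpoint and gains of the voltage setting controllers -/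
  vSP : ∀ m, Fin (nS m) → ℝ
  ω : ∀ m, Fin (nS m) → ℝ
  ψV : ∀ m, Fin (nS m) → ℝ
  ψI : ∀ m, Fin (nS m) → ℝ
  vSP_nonneg : ∀ m j, 0 ≤ vSP m j
  ω_pos : ∀ m j, 0 < ω m j
  ψV_pos : ∀ m j, 0 < ψV m j
  ψI_pos : ∀ m j, 0 < ψI m j
  /-- gains of the voltage following controllers -/
  α : ∀ m, Fin (nF m) → ℝ
  β : ∀ m, Fin (nF m) → ℝ
  τ : ∀ m, Fin (nF m) → ℝ
  α_pos : ∀ m k, 0 < α m k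
  β_pos : ∀ m k, 0 < β m k
  τ_pos : ∀ m k, 0 < τ m k

/-- Indices of the state of a cluster with `s` voltage setting buses, `f` voltage following buses
and `e` lines: integrator states `z`, transformed filter currents `ia = i + δ v` and voltages `v`
of the voltage setting (`S`) and voltage following (`F`) buses, and line currents `iE`. -/
inductive ClusterIdx (s f e : ℕ) : Type
  | zS (j : Fin s)
  | iaS (j : Fin s)
  | vS (j : Fin s)
  | zF (k : Fin f)
  | iaF (k : Fin f)
  | vF (k : Fin f)
  | iE (l : Fin e)
  deriving DecidableEq, Fintype

namespace Microgrid

variable (G : Microgrid)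

/-- The buses of cluster `m`. -/
abbrev Bus (m : Fin G.M) : Type := Fin (G.nS m) ⊕ Fin (G.nF m)

/-- The state indices of cluster `m`. -/
abbrev Idx (m : Fin G.M) : Type := ClusterIdx (G.nS m) (G.nF m) (G.nE m)

/-- The monotone part `v ↦ i_L(v) + Y v` of the load at a bus. -/
def monotoneLoad (m : Fin G.M) (n : G.Bus m) (v : ℝ) : ℝ := G.load m n v + G.Y m n * v

/-- Total effective capacitance at a bus: filter capacitance plus half the capacitance of every
line that ends at the bus. -/
def Ceq (m : Fin G.M) (n : G.Bus m) : ℝ :=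
  G.C m n
    + ∑ l : Fin (G.nE m), (if G.snkE m l = n ∨ G.srcE m l = n then G.CE m l / 2 else 0)
    + ∑ l : Fin G.nT, (if G.snkT l = ⟨m, n⟩ ∨ G.srcT l = ⟨m, n⟩ then G.CT l / 2 else 0)

/-- Incidence matrix of the graph of cluster `m`: `1` at the sink and `-1` at the source of a
line. -/
def E (m : Fin G.M) : Matrix (G.Bus m) (Fin (G.nE m)) ℝ := Matrix.of fun n l =>
  (if G.snkE m l = n then 1 else 0) - (if G.srcE m l = n then 1 else 0)

/-- Net current that the lines belonging to no cluster carry into bus `n` of cluster `m`, when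
their currents are `i`. -/
def netT (i : Fin G.nT → ℝ) (m : Fin G.M) (n : G.Bus m) : ℝ :=
  (∑ l : Fin G.nT, if G.snkT l = ⟨m, n⟩ then i l else 0)
    - ∑ l : Fin G.nT, if G.srcT l = ⟨m, n⟩ then i l else 0

/-! ### The assumed steady state -/

/-- Candidate steady-state values of the microgrid with its converters as open-loop inputs:
filter currents of the voltage setting buses, voltages of the voltage following buses, converter
voltages of all buses, and currents of all lines. The filter currents of the voltage following
buses are zero and the voltages of the voltage setting buses are the setpoints. -/
structure SteadyState where
  iS : ∀ m, Fin (G.nS m) → ℝ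
  vF : ∀ m, Fin (G.nF m) → ℝ
  vVSC : ∀ m, G.Bus m → ℝ
  iE : ∀ m, Fin (G.nE m) → ℝ
  iT : Fin G.nT → ℝ

variable {G}

/-- Steady-state filter currents of all buses of cluster `m`. -/
def SteadyState.i (e : G.SteadyState) (m : Fin G.M) : G.Bus m → ℝ :=
  Sum.elim (e.iS m) 0

/-- Steady-state voltages of all buses of cluster `m`. -/
def SteadyState.v (e : G.SteadyState) (m : Fin G.M) : G.Bus m → ℝ :=
  Sum.elim (G.vSP m) (e.vF m)

/-- Steady-state exogenous input currents: net current of the lines belonging to no cluster, minus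
the monotone part of the load. -/
def SteadyState.iEx (e : G.SteadyState) (m : Fin G.M) (n : G.Bus m) : ℝ :=
  G.netT e.iT m n - G.monotoneLoad m n (e.v m n)

/-- The equilibrium assumption: the values `e` make the right-hand sides of the uncontrolled
dynamics `L i' = -R i - v + v_VSC`, `Ceq v' = i + Y v + E i_E + i_Ex` of every bus and
`L i' = -R i + v_source - v_sink` of every line vanish, with nonnegative bus voltages. -/
structure SteadyState.IsEquilibrium (e : G.SteadyState) : Prop where
  vF_nonneg : ∀ m k, 0 ≤ e.vF m k
  filter : ∀ m n, -G.R m n * e.i m n - e.v m n + e.vVSC m n = 0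
  bus : ∀ m n, e.i m n + G.Y m n * e.v m n + (G.E m).mulVec (e.iE m) n + e.iEx m n = 0
  lineE : ∀ m l, -G.RE m l * e.iE m l + e.v m (G.srcE m l) - e.v m (G.snkE m l) = 0
  lineT : ∀ l, -G.RT l * e.iT l + e.v (G.srcT l).1 (G.srcT l).2
    - e.v (G.snkT l).1 (G.snkT l).2 = 0

variable (G)

/-! ### Shifted closed-loop cluster dynamics `Q x' = A x + B u`, `y = Bᵀ x` -/

/-- Modified gain `ψI + R`. -/
def ψIMod (m : Fin G.M) (j : Fin (G.nS m)) : ℝ := G.ψI m j + G.R m (.inl j)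

/-- Modified gain `ψV + 1 - δ (ψI + R)`. -/
def ψVMod (m : Fin G.M) (j : Fin (G.nS m)) : ℝ :=
  G.ψV m j + 1 - G.δ m (.inl j) * G.ψIMod m j

/-- Modified gain `L ω`. -/
def ωMod (m : Fin G.M) (j : Fin (G.nS m)) : ℝ := G.L m (.inl j) * G.ω m j

/-- Modified gain `R + β`. -/
def βMod (m : Fin G.M) (k : Fin (G.nF m)) : ℝ := G.R m (.inr k) + G.β m k

/-- Modified gain `α - (R + β) δ`. -/
def αMod (m : Fin G.M) (k : Fin (G.nF m)) : ℝ := G.α m k - G.βMod m k * G.δ m (.inr k)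

/-- Diagonal of the matrix `Q`. -/
def q (m : Fin G.M) : G.Idx m → ℝ
  | .zS j => G.L m (.inl j)
  | .iaS j => G.L m (.inl j)
  | .vS j => G.Ceq m (.inl j)
  | .zF _ => 1
  | .iaF k => G.L m (.inr k)
  | .vF k => G.Ceq m (.inr k)
  | .iE l => G.LE m l

/-- The diagonal matrix `Q` of cluster `m`. -/
def Q (m : Fin G.M) : Matrix (G.Idx m) (G.Idx m) ℝ := Matrix.diagonal (G.q m)

/-- The entries of the matrix `A` of cluster `m`; each line is one nonzero block. -/
def Aentry (m : Fin G.M) : G.Idx m → G.Idx m → ℝ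
  | .zS j, .vS j' => if j = j' then G.ωMod m j else 0
  | .iaS j, .zS j' => if j = j' then -1 else 0
  | .iaS j, .iaS j' => if j = j' then -G.ψIMod m j else 0
  | .iaS j, .vS j' => if j = j' then -G.ψVMod m j else 0
  | .vS j, .iaS j' => if j = j' then 1 else 0
  | .vS j, .vS j' => if j = j' then G.Y m (.inl j) - G.δ m (.inl j) else 0
  | .vS j, .iE l => G.E m (.inl j) l
  | .zF k, .zF k' => if k = k' then -G.τ m k else 0
  | .zF k, .vF k' => if k = k' then G.τ m k * G.α m k else 0
  | .iaF k, .zF k' => if k = k' then 1 else 0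
  | .iaF k, .iaF k' => if k = k' then -G.βMod m k else 0
  | .iaF k, .vF k' => if k = k' then -G.αMod m k else 0
  | .vF k, .iaF k' => if k = k' then 1 else 0
  | .vF k, .vF k' => if k = k' then G.Y m (.inr k) - G.δ m (.inr k) else 0
  | .vF k, .iE l => G.E m (.inr k) l
  | .iE l, .vS j => -G.E m (.inl j) l
  | .iE l, .vF k => -G.E m (.inr k) l
  | .iE l, .iE l' => if l = l' then -G.RE m l else 0
  | _, _ => 0

/-- The state matrix `A` of cluster `m`. -/
def A (m : Fin G.M) : Matrix (G.Idx m) (G.Idx m) ℝ := Matrix.of (G.Aentry m)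

/-- The entries of the matrix `B` of cluster `m`. -/
def Bentry (m : Fin G.M) : G.Idx m → G.Bus m → ℝ
  | .vS j, .inl j' => if j = j' then 1 else 0
  | .vF k, .inr k' => if k = k' then 1 else 0
  | _, _ => 0

/-- The input matrix `B` of cluster `m`; its transpose is the output matrix. -/
def B (m : Fin G.M) : Matrix (G.Idx m) (G.Bus m) ℝ := Matrix.of (G.Bentry m)

/-- The linear matrix inequality conditions for cluster `m`. Over `ℝ`, `Matrix.PosDef` and
`Matrix.PosSemidef` include symmetry. -/
def LMI (m : Fin G.M) : Prop :=
  ∃ P : Matrix (G.Idx m) (G.Idx m) ℝ, P.PosDef ∧ ∃ ε : ℝ, 0 < ε ∧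
    (-(G.Q m * P * G.A m + (G.A m).transpose * P * G.Q m
      + ε • (G.B m * (G.B m).transpose))).PosSemidef ∧
    G.Q m * P * G.B m = G.B m

/-! ### The interconnected microgrid in error variables -/

/-- Error state of the microgrid: the error state of every cluster, and the error currents of the
lines that belong to no cluster. -/
abbrev State : Type := (∀ m, G.Idx m → ℝ) × (Fin G.nT → ℝ)

variable {G}

/-- Output (bus voltage errors) of cluster `m`. -/
def output (m : Fin G.M) (x : G.State) : G.Bus m → ℝ := (G.B m).transpose.mulVec (x.1 m)

/-- Shifted monotone load at a bus, as a function of the voltage error. -/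
def SteadyState.shiftedLoad (e : G.SteadyState) (m : Fin G.M) (n : G.Bus m) (w : ℝ) : ℝ :=
  G.monotoneLoad m n (w + e.v m n) - G.monotoneLoad m n (e.v m n)

/-- Exogenous input current errors of cluster `m`. -/
def SteadyState.input (e : G.SteadyState) (m : Fin G.M) (x : G.State) (n : G.Bus m) : ℝ :=
  G.netT x.2 m n - e.shiftedLoad m n (output m x n)

/-- Vector field of the microgrid in error variables: `Q x' = A x + B u` for every cluster, and
`L i' = -R i + v_source - v_sink` for every line that belongs to no cluster. -/
def SteadyState.field (e : G.SteadyState) (x : G.State) : G.State :=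
  (fun m => (G.Q m)⁻¹.mulVec ((G.A m).mulVec (x.1 m) + (G.B m).mulVec (e.input m x)),
   fun l => (-G.RT l * x.2 l + output (G.srcT l).1 x (G.srcT l).2
      - output (G.snkT l).1 x (G.snkT l).2) / G.LT l)

end Microgrid

end

/-! ### Global solutions of Lipschitz autonomous equations. -/

section Existence

variable {X : Type*} [NormedAddCommGroup X] [NormedSpace ℝ X]

/-! The storage function is the sum of the quadratic forms with matrices `Q P Q` of the clusters and
the magnetic energies of the lines in `T`. The weight `Q P Q` cancels the `Q⁻¹` of the vector field,
so its derivative contains exactly `Q P A` and `Q P B`. The LMI bounds the first by minus `ε` times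
the squared bus voltage errors, and `Q P B = B` turns the second into the power voltage times input.
In that power, shifted loads contribute nonpositively because they are monotone, and the currents of
`T` cancel against the power drawn by the lines themselves, leaving their resistive losses
(`storageRate_le`).

The storage function is positive definite, which gives Lyapunov stability and bounded solutions; the
loads are globally Lipschitz, so solutions exist for all time. The dissipation is only semidefinite
in the state. By Barbalat's lemma it tends to zero along every solution, hence so do the bus
voltages and the currents of `T` (`tendsto_zero_of_dissipation`).

The remaining states follow (`tendsto_zero_of_output`). Line currents inside clusters and the
controller states of voltage following buses are stable first-order filters driven by vanishing
inputs. The integrators of voltage setting buses have no decay of their own; there Barbalat is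
applied twice more: voltages tend to zero, so their derivatives do, which forces the filter currents
to zero, and the same argument one level up forces the integrators to zero. -/

/-- A globally Lipschitz vector field has solutions on a time interval whose length does not
depend on the initial state. -/
theorem LipschitzWith.exists_hasDerivWithinAt_Icc [CompleteSpace X] {f : X → X} {K : NNReal}
    (hf : LipschitzWith K f) :
    ∃ h > 0, ∀ x₀ : X, ∃ x : ℝ → X, x 0 = x₀ ∧
      ∀ t ∈ Set.Icc 0 h, HasDerivWithinAt x (f (x t)) (Set.Icc 0 h) t := by
  have hK : (0 : ℝ) < K + 1 := by positivity
  -- With `F = ‖f x₀‖`, the speed on the ball of radius `F + 1` is at most `F + K (F + 1)`. This is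
  -- below `(K + 1) (F + 1)`, so a solution cannot leave the ball before time `1 / (K + 1)`,
  -- whatever `x₀` is.
  refine ⟨1 / (K + 1), by positivity, fun x₀ => ?_⟩
  have h0 : (0 : ℝ) ∈ Set.Icc (0 : ℝ) (1 / (K + 1)) := ⟨le_rfl, by positivity⟩
  have hPL : IsPicardLindelof (fun _ : ℝ => f) (⟨0, h0⟩ : Set.Icc (0 : ℝ) (1 / (K + 1))) x₀
      (‖f x₀‖₊ + 1) 0 (‖f x₀‖₊ + K * (‖f x₀‖₊ + 1)) K := by
    refine ⟨fun t _ => hf.lipschitzOnWith, fun x _ => continuousOn_const, fun t _ x hx => ?_, ?_⟩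
    · have h1 : ‖f x - f x₀‖ ≤ K * ‖x - x₀‖ := by
        simpa [dist_eq_norm] using hf.dist_le_mul x x₀
      have h2 : ‖x - x₀‖ ≤ ‖f x₀‖ + 1 := by
        simpa [dist_eq_norm] using Metric.mem_closedBall.1 hx
      have h3 : ‖f x‖ ≤ ‖f x₀‖ + ‖f x - f x₀‖ := by
        simpa using norm_add_le (f x₀) (f x - f x₀)
      have h4 := mul_le_mul_of_nonneg_left h2 K.coe_nonneg
      push_cast
      linarith
    · push_cast
      simp only [sub_zero, sub_self]
      rw [max_eq_left (by positivity), mul_one_div, div_le_iff₀ hK]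
      nlinarith [norm_nonneg (f x₀), K.coe_nonneg]
  obtain ⟨x, hx0, hx⟩ := hPL.exists_eq_forall_mem_Icc_hasDerivWithinAt₀
  exact ⟨x, hx0, hx⟩

/-- A globally Lipschitz vector field has a solution on `[0, ∞)` from every initial state. -/
theorem LipschitzWith.exists_isSolution [CompleteSpace X] {f : X → X} {K : NNReal}
    (hf : LipschitzWith K f) (x₀ : X) : ∃ x : ℝ → X, IsSolution f x ∧ x 0 = x₀ := by
  obtain ⟨h, hh, hex⟩ := hf.exists_hasDerivWithinAt_Icc
  choose γ hγ0 hγ using hex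
  -- The states at the times `n * h`; the pieces started there are glued into one curve.
  let p : ℕ → X := fun n => Nat.rec x₀ (fun _ y => γ y h) n
  have hp : ∀ n, p (n + 1) = γ (p n) h := fun n => rfl
  let x : ℝ → X := fun t => γ (p ⌊t / h⌋₊) (t - ⌊t / h⌋₊ * h)
  -- The formula holds on the closed interval: at the right end the floor jumps to `n + 1`, but the
  -- next piece starts where this one ends.
  have hx : ∀ (n : ℕ) (t : ℝ), t ∈ Set.Icc (n * h) ((n + 1) * h) → x t = γ (p n) (t - n * h) := by
    intro n t ht
    rcases ht.2.eq_or_lt with rfl | hlt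
    · have : ((n : ℝ) + 1) * h / h = ((n + 1 : ℕ) : ℝ) := by
        push_cast
        field_simp
      simp only [x, this, Nat.floor_natCast, hp]
      push_cast
      rw [sub_self, hγ0]
      congr 1
      ring
    · have : ⌊t / h⌋₊ = n := by
        rw [Nat.floor_eq_iff (div_nonneg (le_trans (by positivity) ht.1) hh.le),
          le_div_iff₀ hh, div_lt_iff₀ hh]
        exact ⟨ht.1, hlt⟩
      simp only [x, this]
  have hd : ∀ (n : ℕ) (t : ℝ), t ∈ Set.Icc (n * h) ((n + 1) * h) →
      HasDerivWithinAt x (f (x t)) (Set.Icc (n * h) ((n + 1) * h)) t := by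
    intro n t ht
    have hmaps : Set.MapsTo (fun s : ℝ => s - n * h) (Set.Icc (n * h) ((n + 1) * h))
        (Set.Icc 0 h) := fun s hs => ⟨by linarith [hs.1], by linarith [hs.2]⟩
    have h1 := (hγ (p n) (t - n * h) (hmaps ht)).scomp t
      (((hasDerivAt_id t).sub_const (n * h)).hasDerivWithinAt) hmaps
    rw [one_smul] at h1
    rw [hx n t ht]
    exact h1.congr (fun s hs => hx n s hs) (hx n t ht)
  refine ⟨x, fun t ht => ?_, ?_⟩
  · set n := ⌊t / h⌋₊ with hn
    have hn1 : n * h ≤ t := by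
      rw [← le_div_iff₀ hh]
      exact Nat.floor_le (div_nonneg ht hh.le)
    have hn2 : t < (n + 1) * h := by
      rw [← div_lt_iff₀ hh]
      exact Nat.lt_floor_add_one _
    have hr := hd n t ⟨hn1, hn2.le⟩
    -- At a positive grid point the one-sided derivatives of the two adjacent pieces agree and
    -- combine; at time zero only the right one is needed.
    rcases hn1.eq_or_lt with heq | hlt
    · have hr' : HasDerivWithinAt x (f (x t)) (Set.Ici t) t := by
        refine hr.mono_of_mem_nhdsWithin ?_
        rw [heq]
        exact Icc_mem_nhdsGE hn2
      rcases Nat.eq_zero_or_pos n with h0 | hpos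
      · have : t = 0 := by rw [← heq, h0]; simp
        rwa [this] at hr' ⊢
      · obtain ⟨k, hk⟩ : ∃ k, n = k + 1 := ⟨n - 1, by omega⟩
        have hk' : t = (k + 1) * h := by rw [← heq, hk]; push_cast; ring
        have hkt : (k : ℝ) * h < t := by rw [hk']; nlinarith
        have hl := hd k t ⟨hkt.le, hk'.le⟩
        have hl' : HasDerivWithinAt x (f (x t)) (Set.Iic t) t := by
          refine hl.mono_of_mem_nhdsWithin ?_
          rw [← hk']
          exact Icc_mem_nhdsLE hkt
        have := hl'.union hr'
        rw [Set.Iic_union_Ici] at this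
        exact this.mono (Set.subset_univ _)
    · exact (hr.hasDerivAt (Icc_mem_nhds hlt hn2)).hasDerivWithinAt
  · have := hx 0 0 (by simp [hh.le])
    rw [this, Nat.cast_zero, zero_mul, sub_zero]
    exact hγ0 x₀

end Existence

/-! ### Barbalat's lemma and vanishing inputs of stable scalar systems. -/

section Asymptotics

/-- **Barbalat's lemma.** -/
theorem tendsto_deriv_zero_of_uniformContinuousOn {φ φ' : ℝ → ℝ} {c : ℝ}
    (hφ : ∀ t, 0 ≤ t → HasDerivWithinAt φ (φ' t) (Set.Ici 0) t)
    (hlim : Tendsto φ atTop (𝓝 c)) (huc : UniformContinuousOn φ' (Set.Ici 0)) :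
    Tendsto φ' atTop (𝓝 0) := by
  rw [Metric.tendsto_atTop]
  intro ε hε
  obtain ⟨d, hd, hd'⟩ := Metric.uniformContinuousOn_iff.1 huc (ε / 2) (half_pos hε)
  have hslope : Tendsto (fun t => (φ (t + d) - φ t) / d) atTop (𝓝 0) := by
    have := ((hlim.comp (tendsto_atTop_add_const_right atTop d tendsto_id)).sub hlim).div_const d
    simpa using this
  obtain ⟨T, hT⟩ := Metric.tendsto_atTop.1 hslope (ε / 2) (half_pos hε)
  refine ⟨max T 0, fun t ht => ?_⟩
  have ht0 : 0 ≤ t := (le_max_right _ _).trans ht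
  have htT := hT t ((le_max_left _ _).trans ht)
  -- The difference quotient over a window of fixed length `d` tends to zero and equals `φ' s` for
  -- some `s` within `d` of `t`; uniform continuity carries this to `φ' t`.
  obtain ⟨s, hs, hs'⟩ := exists_hasDerivAt_eq_slope φ φ' (show t < t + d by linarith)
    (fun r hr => ((hφ r (ht0.trans hr.1)).continuousWithinAt).mono fun _ hu => ht0.trans hu.1)
    (fun r hr => (hφ r (ht0.trans hr.1.le)).hasDerivAt (Ici_mem_nhds (ht0.trans_lt hr.1)))
  rw [add_sub_cancel_left] at hs'
  have h1 := hd' t ht0 s (ht0.trans hs.1.le) (by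
    rw [Real.dist_eq, abs_sub_comm, abs_of_pos (by linarith [hs.1])]
    linarith [hs.2])
  rw [← hs'] at htT
  linarith [dist_triangle (φ' t) (φ' s) 0]

/-- A function on `[0, ∞)` with nonpositive derivative is antitone there. -/
theorem antitoneOn_Ici_of_hasDerivWithinAt_nonpos {φ φ' : ℝ → ℝ} {T : ℝ} (hT : 0 ≤ T)
    (hφ : ∀ t, 0 ≤ t → HasDerivWithinAt φ (φ' t) (Set.Ici 0) t)
    (hneg : ∀ t, T ≤ t → φ' t ≤ 0) : AntitoneOn φ (Set.Ici T) := by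
  refine antitoneOn_of_hasDerivWithinAt_nonpos (f' := φ') (convex_Ici T)
    (fun t ht => ((hφ t (hT.trans ht)).continuousWithinAt).mono (Set.Ici_subset_Ici.2 hT))
    (fun t ht => ?_) (fun t ht => ?_)
  · exact (hφ t (hT.trans (interior_subset ht))).mono
      (interior_subset.trans (Set.Ici_subset_Ici.2 hT))
  · exact hneg t (interior_subset ht)

/-- Integrating factor: once `w < a * (ε / 2)`, the function `exp (a t) * (φ t - ε / 2)` is
antitone, so `φ` exceeds `ε / 2` by at most an exponentially small term. The matching lower bound
comes from applying this to `-φ`. -/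
theorem eventually_lt_of_hasDerivWithinAt_linear {φ w : ℝ → ℝ} {a : ℝ} (ha : 0 < a)
    (hφ : ∀ t, 0 ≤ t → HasDerivWithinAt φ (-a * φ t + w t) (Set.Ici 0) t)
    (hw : Tendsto w atTop (𝓝 0)) {ε : ℝ} (hε : 0 < ε) : ∀ᶠ t in atTop, φ t < ε := by
  obtain ⟨T₀, hT₀⟩ := eventually_atTop.1 (hw.eventually_lt_const (show 0 < a * (ε / 2) by positivity))
  set T := max T₀ 0
  have hT : 0 ≤ T := le_max_right _ _
  have hanti : AntitoneOn (fun t => Real.exp (a * t) * (φ t - ε / 2)) (Set.Ici T) := by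
    refine antitoneOn_Ici_of_hasDerivWithinAt_nonpos
      (φ' := fun t => Real.exp (a * t) * (w t - a * (ε / 2))) hT (fun t ht => ?_) (fun t ht => ?_)
    · have h1 : HasDerivAt (fun t : ℝ => Real.exp (a * t)) (Real.exp (a * t) * a) t := by
        simpa using ((hasDerivAt_id t).const_mul a).exp
      refine (h1.hasDerivWithinAt.mul ((hφ t ht).sub_const (ε / 2))).congr_deriv ?_
      ring
    · exact mul_nonpos_of_nonneg_of_nonpos (Real.exp_pos _).le
        (sub_nonpos.2 (hT₀ t ((le_max_left _ _).trans ht)).le)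
  have hexp : Tendsto (fun t : ℝ => Real.exp (-(a * t)) * (Real.exp (a * T) * (φ T - ε / 2)))
      atTop (𝓝 0) := by
    have : Tendsto (fun t : ℝ => Real.exp (-(a * t))) atTop (𝓝 0) :=
      Real.tendsto_exp_neg_atTop_nhds_zero.comp (tendsto_id.const_mul_atTop ha)
    simpa using this.mul_const (Real.exp (a * T) * (φ T - ε / 2))
  filter_upwards [hexp.eventually_lt_const (half_pos hε), eventually_ge_atTop T] with t h1 h2
  have h3 := mul_le_mul_of_nonneg_left (hanti Set.self_mem_Ici h2 h2)
    (Real.exp_pos (-(a * t))).le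
  simp only at h3
  rw [← mul_assoc, ← Real.exp_add, neg_add_cancel, Real.exp_zero, one_mul] at h3
  linarith

/-- A stable scalar linear system whose input tends to zero tends to zero. -/
theorem tendsto_zero_of_hasDerivWithinAt_linear {φ w : ℝ → ℝ} {a : ℝ} (ha : 0 < a)
    (hφ : ∀ t, 0 ≤ t → HasDerivWithinAt φ (-a * φ t + w t) (Set.Ici 0) t)
    (hw : Tendsto w atTop (𝓝 0)) : Tendsto φ atTop (𝓝 0) := by
  rw [tendsto_order]
  refine ⟨fun b hb => ?_, fun b hb => eventually_lt_of_hasDerivWithinAt_linear ha hφ hw hb⟩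
  have := eventually_lt_of_hasDerivWithinAt_linear (φ := fun t => -φ t) (w := fun t => -w t) ha
    (fun t ht => (hφ t ht).neg.congr_deriv (by ring)) (by simpa using hw.neg) (neg_pos.2 hb)
  filter_upwards [this] with t ht
  linarith

variable {X : Type*} [NormedAddCommGroup X] [NormedSpace ℝ X]

/-- A continuous function of the state is uniformly continuous along a bounded solution. -/
theorem IsSolution.uniformContinuousOn_comp [ProperSpace X] {f : X → X} {x : ℝ → X}
    (hx : IsSolution f x) (hf : Continuous f) {ρ : ℝ} (hb : ∀ t, 0 ≤ t → ‖x t‖ ≤ ρ) {g : X → ℝ}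
    (hg : Continuous g) : UniformContinuousOn (fun t => g (x t)) (Set.Ici 0) := by
  have hmem : Set.MapsTo x (Set.Ici 0) (Metric.closedBall 0 ρ) := fun t ht => by
    simpa using hb t ht
  have hc := isCompact_closedBall (0 : X) ρ
  obtain ⟨D, hD⟩ := hc.exists_bound_of_continuousOn hf.continuousOn
  -- The velocity is bounded on the compact ball that contains the trajectory.
  have hlip : LipschitzOnWith D.toNNReal x (Set.Ici 0) :=
    (convex_Ici (0 : ℝ)).lipschitzOnWith_of_nnnorm_hasDerivWithin_le hx
      fun t ht => NNReal.le_toNNReal_of_coe_le (hD _ (hmem ht))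
  exact (hc.uniformContinuousOn_of_continuous hg.continuousOn).comp hlip.uniformContinuousOn hmem

/-- The usable form of Barbalat: when the derivative is a continuous function of a bounded state,
its uniform continuity is automatic. -/
theorem IsSolution.tendsto_deriv_zero [ProperSpace X] {f : X → X} {x : ℝ → X}
    (hx : IsSolution f x) (hf : Continuous f) {ρ : ℝ} (hb : ∀ t, 0 ≤ t → ‖x t‖ ≤ ρ) {g : X → ℝ}
    (hg : Continuous g) {φ : ℝ → ℝ} {c : ℝ}
    (hφ : ∀ t, 0 ≤ t → HasDerivWithinAt φ (g (x t)) (Set.Ici 0) t)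
    (hlim : Tendsto φ atTop (𝓝 c)) : Tendsto (fun t => g (x t)) atTop (𝓝 0) :=
  tendsto_deriv_zero_of_uniformContinuousOn hφ hlim (hx.uniformContinuousOn_comp hf hb hg)

end Asymptotics

/-! ### Quadratic Lyapunov functions. -/

section Lyapunov

variable {X : Type*} [NormedAddCommGroup X] [NormedSpace ℝ X]

/-- A continuous positive function that is homogeneous of degree two dominates a multiple of the
squared norm. -/
theorem exists_pos_mul_norm_sq_le [ProperSpace X] {V : X → ℝ} (hV : Continuous V)
    (hsmul : ∀ (r : ℝ) (x : X), V (r • x) = r ^ 2 * V x) (hpos : ∀ x, x ≠ 0 → 0 < V x) :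
    ∃ c > 0, ∀ x, c * ‖x‖ ^ 2 ≤ V x := by
  have h0 : V 0 = 0 := by simpa using hsmul 0 0
  rcases (Metric.sphere (0 : X) 1).eq_empty_or_nonempty with hE | hne
  · refine ⟨1, one_pos, fun x => ?_⟩
    have : x = 0 := by
      by_contra hx
      have : ‖x‖⁻¹ • x ∈ Metric.sphere (0 : X) 1 := by
        simp [norm_smul, norm_ne_zero_iff.2 hx]
      simp [hE] at this
    simp [this, h0]
  · obtain ⟨u, hu, hmin⟩ := (isCompact_sphere (0 : X) 1).exists_isMinOn hne hV.continuousOn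
    refine ⟨V u, hpos u (fun h => by simp [h] at hu), fun x => ?_⟩
    rcases eq_or_ne x 0 with rfl | hx
    · simp [h0]
    · have hn := norm_pos_iff.2 hx
      have h1 : V u ≤ V (‖x‖⁻¹ • x) := hmin (by simp [norm_smul, hn.ne'])
      rw [hsmul, inv_pow, ← div_eq_inv_mul, le_div_iff₀ (by positivity)] at h1
      exact h1

/-- Lyapunov's direct method with a quadratic function: the equilibrium `0` of a globally
Lipschitz vector field is asymptotically stable if bounded solutions converge to it. -/
theorem isAsymptoticallyStable_zero_of_lyapunov [ProperSpace X] {f : X → X} {K : NNReal}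
    (hf : LipschitzWith K f) (hf0 : f 0 = 0) {V V' : X → ℝ} (hV : Continuous V)
    (hsmul : ∀ (r : ℝ) (x : X), V (r • x) = r ^ 2 * V x) (hpos : ∀ x, x ≠ 0 → 0 < V x)
    (hderiv : ∀ x, IsSolution f x →
      ∀ t, 0 ≤ t → HasDerivWithinAt (fun s => V (x s)) (V' (x t)) (Set.Ici 0) t)
    (hV' : Continuous V') (hneg : ∀ x, V' x ≤ 0)
    (hconv : ∀ (x : ℝ → X) (ρ : ℝ), IsSolution f x → (∀ t, 0 ≤ t → ‖x t‖ ≤ ρ) →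
      Tendsto (fun t => V' (x t)) atTop (𝓝 0) → Tendsto x atTop (𝓝 0)) :
    IsAsymptoticallyStable f 0 := by
  obtain ⟨c, hc, hcV⟩ := exists_pos_mul_norm_sq_le hV hsmul hpos
  have h0 : V 0 = 0 := by simpa using hsmul 0 0
  have hanti : ∀ x, IsSolution f x → AntitoneOn (fun s => V (x s)) (Set.Ici 0) := fun x hx =>
    antitoneOn_Ici_of_hasDerivWithinAt_nonpos le_rfl (hderiv x hx) fun t _ => hneg _
  have hle : ∀ x, IsSolution f x → ∀ t, 0 ≤ t → c * ‖x t‖ ^ 2 ≤ V (x 0) := fun x hx t ht =>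
    (hcV _).trans (hanti x hx Set.self_mem_Ici ht ht)
  refine ⟨hf0, ⟨1, one_pos, fun x₀ _ => hf.exists_isSolution x₀⟩, fun ε hε => ?_,
    ⟨1, one_pos, fun x hx _ => ?_⟩⟩
  · obtain ⟨r, hr, hr'⟩ := Metric.eventually_nhds_iff.1
      (hV.continuousAt.eventually_lt (continuousAt_const (y := c * ε ^ 2))
        (show V 0 < c * ε ^ 2 by rw [h0]; positivity))
    refine ⟨r, hr, fun x hx hx0 t ht => ?_⟩
    rw [sub_zero] at hx0 ⊢
    have h1 : V (x 0) < c * ε ^ 2 := hr' (by simpa using hx0)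
    have h2 := (hle x hx t ht).trans_lt h1
    exact lt_of_pow_lt_pow_left₀ 2 hε.le (lt_of_mul_lt_mul_left h2 hc.le)
  · have hb : ∀ t, 0 ≤ t → ‖x t‖ ≤ √(V (x 0) / c) := fun t ht => by
      refine Real.le_sqrt_of_sq_le ?_
      rw [le_div_iff₀' hc]
      exact hle x hx t ht
    have hVnn : ∀ y, 0 ≤ V y := fun y => le_trans (by positivity) (hcV y)
    obtain ⟨v, hv⟩ : ∃ v, Tendsto (fun t => V (x t)) atTop (𝓝 v) := by
      -- Clamping time at zero extends the monotonicity to the whole line, where monotone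
      -- convergence applies.
      have hA : Antitone fun t => V (x (max t 0)) := fun s t hst =>
        hanti x hx (le_max_right s 0) (le_max_right t 0) (max_le_max_right 0 hst)
      refine ⟨_, (tendsto_atTop_ciInf hA ⟨0, ?_⟩).congr' ?_⟩
      · rintro _ ⟨t, rfl⟩
        exact hVnn _
      · filter_upwards [eventually_ge_atTop 0] with t ht
        rw [max_eq_left ht]
    exact hconv x _ hx hb (hx.tendsto_deriv_zero hf.continuous hb hV' (hderiv x hx) hv)

end Lyapunov

/-! ### Derivatives of quadratic forms and the LMI as a scalar inequality. -/

section QuadraticForms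

open Matrix

variable {ι κ : Type*} [Fintype ι] [Fintype κ]

theorem hasDerivWithinAt_dotProduct_mulVec {S : Matrix ι ι ℝ} (hS : Sᵀ = S) {ξ : ℝ → ι → ℝ}
    {ξ' : ι → ℝ} {s : Set ℝ} {t : ℝ} (hξ : HasDerivWithinAt ξ ξ' s t) :
    HasDerivWithinAt (fun r => ξ r ⬝ᵥ (S *ᵥ ξ r)) (2 * (ξ t ⬝ᵥ (S *ᵥ ξ'))) s t := by
  have hi := hasDerivWithinAt_pi.1 hξ
  have hd : HasDerivWithinAt (fun r => ξ r ⬝ᵥ (S *ᵥ ξ r))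
      (ξ' ⬝ᵥ (S *ᵥ ξ t) + ξ t ⬝ᵥ (S *ᵥ ξ')) s t := by
    have := HasDerivWithinAt.fun_sum (u := Finset.univ) fun i _ => (hi i).mul
      (HasDerivWithinAt.fun_sum (u := Finset.univ) fun j _ => (hi j).const_mul (S i j))
    refine this.congr_deriv ?_
    simp only [dotProduct, mulVec, Finset.sum_add_distrib]
  refine hd.congr_deriv ?_
  rw [dotProduct_mulVec ξ', ← mulVec_transpose, hS, dotProduct_comm, two_mul]

/-- A matrix and its transpose have the same quadratic form, and that of `D * Dᵀ` is a sum of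
squares. Used with `N = Q P A` and `D = B`, so that `Dᵀ *ᵥ ξ` is the output. -/
theorem two_mul_dotProduct_mulVec_le {N : Matrix ι ι ℝ} {D : Matrix ι κ ℝ} {ε : ℝ}
    (h : (-(N + Nᵀ + ε • (D * Dᵀ))).PosSemidef) (ξ : ι → ℝ) :
    2 * (ξ ⬝ᵥ (N *ᵥ ξ)) ≤ -(ε * (Dᵀ *ᵥ ξ ⬝ᵥ Dᵀ *ᵥ ξ)) := by
  have h1 := h.dotProduct_mulVec_nonneg ξ
  have h2 : ξ ⬝ᵥ (Nᵀ *ᵥ ξ) = ξ ⬝ᵥ (N *ᵥ ξ) := by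
    rw [dotProduct_mulVec, vecMul_transpose, dotProduct_comm]
  have h3 : ξ ⬝ᵥ ((D * Dᵀ) *ᵥ ξ) = Dᵀ *ᵥ ξ ⬝ᵥ Dᵀ *ᵥ ξ := by
    rw [← mulVec_mulVec, dotProduct_mulVec, ← mulVec_transpose]
  simp only [star_trivial, neg_mulVec, add_mulVec, smul_mulVec, dotProduct_neg, dotProduct_add,
    dotProduct_smul, h2, h3, smul_eq_mul] at h1
  linarith

end QuadraticForms

/-! ### Closure properties of Lipschitz maps, with the constant left existential. -/

section Lipschitz

variable {X : Type*} [PseudoEMetricSpace X]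

theorem LipschitzWith.exists_const_mul {f : X → ℝ} (c : ℝ) (hf : ∃ K, LipschitzWith K f) :
    ∃ K, LipschitzWith K fun x => c * f x :=
  hf.imp' _ fun _ h => (lipschitzWith_smul c).comp h

theorem LipschitzWith.exists_add {f g : X → ℝ} (hf : ∃ K, LipschitzWith K f)
    (hg : ∃ K, LipschitzWith K g) : ∃ K, LipschitzWith K fun x => f x + g x :=
  let ⟨_, h⟩ := hf
  let ⟨_, h'⟩ := hg
  ⟨_, h.add h'⟩

theorem LipschitzWith.exists_sub {f g : X → ℝ} (hf : ∃ K, LipschitzWith K f)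
    (hg : ∃ K, LipschitzWith K g) : ∃ K, LipschitzWith K fun x => f x - g x :=
  let ⟨_, h⟩ := hf
  let ⟨_, h'⟩ := hg
  ⟨_, h.sub h'⟩

theorem LipschitzWith.exists_sum {ι : Type*} {f : ι → X → ℝ} (s : Finset ι)
    (hf : ∀ i, ∃ K, LipschitzWith K (f i)) : ∃ K, LipschitzWith K fun x => ∑ i ∈ s, f i x := by
  classical
  induction s using Finset.induction_on with
  | empty => exact ⟨0, by simp⟩
  | insert i s hi ih =>
    simp only [Finset.sum_insert hi]
    exact LipschitzWith.exists_add (hf i) ih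

theorem LipschitzWith.exists_pi {ι : Type*} [Fintype ι] {Z : ι → Type*}
    [∀ i, PseudoEMetricSpace (Z i)] {f : X → ∀ i, Z i}
    (hf : ∀ i, ∃ K, LipschitzWith K fun x => f x i) : ∃ K, LipschitzWith K f := by
  choose K hK using hf
  refine ⟨∑ i, K i, fun x y => edist_pi_le_iff.2 fun i => (hK i x y).trans ?_⟩
  gcongr
  exact Finset.single_le_sum (fun _ _ => zero_le) (Finset.mem_univ i)

theorem LipschitzWith.exists_mulVec {ι κ : Type*} [Fintype κ] (N : Matrix ι κ ℝ) {f : X → κ → ℝ}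
    (hf : ∀ j, ∃ K, LipschitzWith K fun x => f x j) (i : ι) :
    ∃ K, LipschitzWith K fun x => N.mulVec (f x) i :=
  LipschitzWith.exists_sum _ fun j => LipschitzWith.exists_const_mul (N i j) (hf j)

end Lipschitz

/-- The state indices of a cluster as a disjoint union. -/
def ClusterIdx.equivSum (s f e : ℕ) :
    ClusterIdx s f e ≃ Fin s ⊕ Fin s ⊕ Fin s ⊕ Fin f ⊕ Fin f ⊕ Fin f ⊕ Fin e where
  toFun
    | .zS j => .inl j
    | .iaS j => .inr (.inl j)
    | .vS j => .inr (.inr (.inl j))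
    | .zF k => .inr (.inr (.inr (.inl k)))
    | .iaF k => .inr (.inr (.inr (.inr (.inl k))))
    | .vF k => .inr (.inr (.inr (.inr (.inr (.inl k)))))
    | .iE l => .inr (.inr (.inr (.inr (.inr (.inr l)))))
  invFun
    | .inl j => .zS j
    | .inr (.inl j) => .iaS j
    | .inr (.inr (.inl j)) => .vS j
    | .inr (.inr (.inr (.inl k))) => .zF k
    | .inr (.inr (.inr (.inr (.inl k)))) => .iaF k
    | .inr (.inr (.inr (.inr (.inr (.inl k))))) => .vF k
    | .inr (.inr (.inr (.inr (.inr (.inr l))))) => .iE l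
  left_inv i := by cases i <;> rfl
  right_inv i := by rcases i with _ | _ | _ | _ | _ | _ | _ <;> rfl

/-- Splits a matrix-vector product into its seven blocks, which makes each component of the dynamics
explicit. -/
theorem ClusterIdx.sum_eq {s f e : ℕ} (g : ClusterIdx s f e → ℝ) :
    ∑ i, g i = ∑ j, g (.zS j) + (∑ j, g (.iaS j) + (∑ j, g (.vS j) + (∑ k, g (.zF k)
      + (∑ k, g (.iaF k) + (∑ k, g (.vF k) + ∑ l, g (.iE l)))))) := by
  rw [← (ClusterIdx.equivSum s f e).symm.sum_comp]
  simp only [Fintype.sum_sum_type]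
  rfl

/-! ### The microgrid: its dynamics, energy balance and convergence. -/

namespace Microgrid

open Matrix

variable {G : Microgrid}

theorem Ceq_pos (m : Fin G.M) (n : G.Bus m) : 0 < G.Ceq m n := by
  unfold Ceq
  have h1 : 0 ≤ ∑ l : Fin (G.nE m),
      (if G.snkE m l = n ∨ G.srcE m l = n then G.CE m l / 2 else 0) :=
    Finset.sum_nonneg fun l _ => by
      have := G.CE_pos m l
      split_ifs <;> positivity
  have h2 : 0 ≤ ∑ l : Fin G.nT,
      (if G.snkT l = ⟨m, n⟩ ∨ G.srcT l = ⟨m, n⟩ then G.CT l / 2 else 0) :=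
    Finset.sum_nonneg fun l _ => by
      have := G.CT_pos l
      split_ifs <;> positivity
  have := G.C_pos m n
  positivity

theorem q_pos (m : Fin G.M) (i : G.Idx m) : 0 < G.q m i := by
  cases i
  case zF => exact one_pos
  all_goals first | exact G.L_pos m _ | exact Ceq_pos m _ | exact G.LE_pos m _

theorem isUnit_det_Q (m : Fin G.M) : IsUnit (G.Q m).det := by
  rw [Q, det_diagonal, isUnit_iff_ne_zero]
  exact Finset.prod_ne_zero_iff.2 fun i _ => (q_pos m i).ne'

theorem Q_inv_mulVec (m : Fin G.M) (w : G.Idx m → ℝ) (i : G.Idx m) :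
    ((G.Q m)⁻¹ *ᵥ w) i = w i / G.q m i := by
  have h : (G.Q m)⁻¹ = diagonal fun i => (G.q m i)⁻¹ := by
    refine inv_eq_right_inv ?_
    rw [Q, diagonal_mul_diagonal, ← diagonal_one]
    congr 1
    funext i
    exact mul_inv_cancel₀ (q_pos m i).ne'
  rw [h, mulVec_diagonal, div_eq_inv_mul]

/-! ### Components of the vector field -/

theorem output_inl (m : Fin G.M) (x : G.State) (j : Fin (G.nS m)) :
    output m x (.inl j) = x.1 m (.vS j) := by
  simp [output, mulVec, dotProduct, ClusterIdx.sum_eq, B, Bentry]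

theorem output_inr (m : Fin G.M) (x : G.State) (k : Fin (G.nF m)) :
    output m x (.inr k) = x.1 m (.vF k) := by
  simp [output, mulVec, dotProduct, ClusterIdx.sum_eq, B, Bentry]

variable (e : G.SteadyState) (x : G.State) (m : Fin G.M)

theorem field_fst (i : G.Idx m) : (e.field x).1 m i
    = ((G.A m *ᵥ x.1 m) i + (G.B m *ᵥ e.input m x) i) / G.q m i := by
  exact Q_inv_mulVec m _ i

theorem field_iaS (j : Fin (G.nS m)) : (e.field x).1 m (.iaS j)
    = (-x.1 m (.zS j) - G.ψIMod m j * x.1 m (.iaS j) - G.ψVMod m j * x.1 m (.vS j))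
      / G.L m (.inl j) := by
  rw [field_fst]
  simp [mulVec, dotProduct, ClusterIdx.sum_eq, A, Aentry, B, Bentry, q]
  ring

theorem field_vS (j : Fin (G.nS m)) : (e.field x).1 m (.vS j)
    = (x.1 m (.iaS j) + ((G.Y m (.inl j) - G.δ m (.inl j)) * x.1 m (.vS j)
      + ∑ l, G.E m (.inl j) l * x.1 m (.iE l) + e.input m x (.inl j))) / G.Ceq m (.inl j) := by
  rw [field_fst]
  simp [mulVec, dotProduct, ClusterIdx.sum_eq, A, Aentry, B, Bentry, q]
  ring

/-- This component, `iaF` and `iE` are arranged as `-a * state + input` with `a > 0`, ready for the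
scalar filter lemma. -/
theorem field_zF (k : Fin (G.nF m)) : (e.field x).1 m (.zF k)
    = -G.τ m k * x.1 m (.zF k) + G.τ m k * G.α m k * x.1 m (.vF k) := by
  rw [field_fst]
  simp [mulVec, dotProduct, ClusterIdx.sum_eq, A, Aentry, B, Bentry, q]

theorem field_iaF (k : Fin (G.nF m)) : (e.field x).1 m (.iaF k)
    = -(G.βMod m k / G.L m (.inr k)) * x.1 m (.iaF k)
      + (x.1 m (.zF k) - G.αMod m k * x.1 m (.vF k)) / G.L m (.inr k) := by
  rw [field_fst]
  simp [mulVec, dotProduct, ClusterIdx.sum_eq, A, Aentry, B, Bentry, q]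
  ring

theorem field_iE (l : Fin (G.nE m)) : (e.field x).1 m (.iE l)
    = -(G.RE m l / G.LE m l) * x.1 m (.iE l)
      + (-(∑ j, G.E m (.inl j) l * x.1 m (.vS j)) - ∑ k, G.E m (.inr k) l * x.1 m (.vF k))
        / G.LE m l := by
  rw [field_fst]
  simp [mulVec, dotProduct, ClusterIdx.sum_eq, A, Aentry, B, Bentry, q]
  ring

/-! ### Regularity of the vector field -/

theorem SteadyState.input_zero : e.input m 0 = 0 := by
  funext n
  simp [SteadyState.input, netT, SteadyState.shiftedLoad, output]

theorem SteadyState.field_zero : e.field 0 = 0 := by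
  refine Prod.ext ?_ ?_
  · funext m
    simp [SteadyState.field, e.input_zero]
  · funext l
    simp [SteadyState.field, output]

theorem exists_lipschitzWith_fst (i : G.Idx m) :
    ∃ K, LipschitzWith K fun x : G.State => x.1 m i :=
  ⟨_, (LipschitzWith.eval (α := fun _ => ℝ) i).comp
    ((LipschitzWith.eval (α := fun m => G.Idx m → ℝ) m).comp LipschitzWith.prod_fst)⟩

theorem exists_lipschitzWith_snd (l : Fin G.nT) :
    ∃ K, LipschitzWith K fun x : G.State => x.2 l :=
  ⟨_, (LipschitzWith.eval (α := fun _ => ℝ) l).comp LipschitzWith.prod_snd⟩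

theorem exists_lipschitzWith_output (n : G.Bus m) :
    ∃ K, LipschitzWith K fun x : G.State => output m x n :=
  LipschitzWith.exists_mulVec _ (exists_lipschitzWith_fst m) n

theorem exists_lipschitzWith_netT (n : G.Bus m) :
    ∃ K, LipschitzWith K fun x : G.State => G.netT x.2 m n := by
  have h : ∀ (p : Prop) [Decidable p] (l : Fin G.nT),
      ∃ K, LipschitzWith K fun x : G.State => if p then x.2 l else 0 := by
    intro p _ l
    split_ifs
    · exact exists_lipschitzWith_snd l
    · exact ⟨0, LipschitzWith.const 0⟩
  exact LipschitzWith.exists_sub (LipschitzWith.exists_sum _ fun l => h _ l)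
    (LipschitzWith.exists_sum _ fun l => h _ l)

theorem SteadyState.exists_lipschitzWith_input (n : G.Bus m) :
    ∃ K, LipschitzWith K fun x : G.State => e.input m x n := by
  refine LipschitzWith.exists_sub (exists_lipschitzWith_netT m n)
    (LipschitzWith.exists_sub ?_ ⟨0, LipschitzWith.const _⟩)
  have h : ∃ K, LipschitzWith K fun x : G.State => output m x n + e.v m n :=
    LipschitzWith.exists_add (exists_lipschitzWith_output m n) ⟨0, LipschitzWith.const _⟩
  obtain ⟨K, hK⟩ := G.load_lipschitz m n
  exact LipschitzWith.exists_add (h.imp' _ fun _ h' => hK.comp h')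
    (LipschitzWith.exists_const_mul _ h)

/-- The loads are the only nonlinearity, and they are globally Lipschitz. -/
theorem SteadyState.exists_lipschitzWith_field : ∃ K, LipschitzWith K e.field := by
  obtain ⟨K₁, h₁⟩ : ∃ K, LipschitzWith K fun x => (e.field x).1 :=
    LipschitzWith.exists_pi fun m => LipschitzWith.exists_pi fun i =>
      LipschitzWith.exists_mulVec (G.Q m)⁻¹
        (f := fun x => G.A m *ᵥ x.1 m + G.B m *ᵥ e.input m x) (fun j => LipschitzWith.exists_add
          (LipschitzWith.exists_mulVec (G.A m) (exists_lipschitzWith_fst m) j)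
          (LipschitzWith.exists_mulVec (G.B m) (e.exists_lipschitzWith_input m) j)) i
  obtain ⟨K₂, h₂⟩ : ∃ K, LipschitzWith K fun x => (e.field x).2 := by
    refine LipschitzWith.exists_pi fun l => ?_
    simp only [SteadyState.field, div_eq_inv_mul]
    exact LipschitzWith.exists_const_mul _ (LipschitzWith.exists_sub (LipschitzWith.exists_add
      (LipschitzWith.exists_const_mul _ (exists_lipschitzWith_snd l))
      (exists_lipschitzWith_output _ _)) (exists_lipschitzWith_output _ _))
  exact ⟨_, h₁.prodMk h₂⟩

theorem continuous_output (n : G.Bus m) : Continuous fun x : G.State => output m x n :=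
  (exists_lipschitzWith_output m n).elim fun _ h => h.continuous

theorem SteadyState.continuous_input : Continuous fun x : G.State => e.input m x :=
  continuous_pi fun n => (e.exists_lipschitzWith_input m n).elim fun _ h => h.continuous

theorem SteadyState.continuous_field_fst (i : G.Idx m) :
    Continuous fun x : G.State => (e.field x).1 m i := by
  obtain ⟨_, h⟩ := e.exists_lipschitzWith_field
  exact (continuous_apply i).comp ((continuous_apply m).comp (continuous_fst.comp h.continuous))

/-! ### The storage function -/

variable (P : ∀ m, Matrix (G.Idx m) (G.Idx m) ℝ)

/-- Storage function of the microgrid: twice the sum of the storage functions of the clusters and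
of the remaining lines. -/
noncomputable def storage (x : G.State) : ℝ :=
  ∑ m, x.1 m ⬝ᵥ ((G.Q m * P m * G.Q m) *ᵥ x.1 m) + ∑ l, G.LT l * x.2 l ^ 2

/-- Derivative of the storage function along the vector field. -/
noncomputable def SteadyState.storageRate (x : G.State) : ℝ :=
  ∑ m, 2 * (x.1 m ⬝ᵥ ((G.Q m * P m) *ᵥ (G.A m *ᵥ x.1 m + G.B m *ᵥ e.input m x)))
    + ∑ l, 2 * x.2 l * (-G.RT l * x.2 l + output (G.srcT l).1 x (G.srcT l).2
      - output (G.snkT l).1 x (G.snkT l).2)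

theorem continuous_storage : Continuous (storage P) := by
  unfold storage
  fun_prop

theorem SteadyState.continuous_storageRate : Continuous (e.storageRate P) := by
  have h1 := fun m => e.continuous_input m
  have h2 := fun m n => continuous_output (G := G) m n
  unfold SteadyState.storageRate
  fun_prop

theorem storage_smul (r : ℝ) : storage P (r • x) = r ^ 2 * storage P x := by
  simp only [storage, Prod.smul_fst, Prod.smul_snd, Pi.smul_apply, mulVec_smul, smul_dotProduct,
    dotProduct_smul, smul_eq_mul, mul_add, Finset.mul_sum]
  congr 1 <;> refine Finset.sum_congr rfl fun _ _ => by ring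

variable {P}

theorem posDef_Q_mul_mul_Q (hP : (P m).PosDef) : (G.Q m * P m * G.Q m).PosDef := by
  have hQ : (G.Q m)ᴴ = G.Q m := by
    rw [conjTranspose_eq_transpose_of_trivial, Q, diagonal_transpose]
  have h := hP.conjTranspose_mul_mul_same (B := G.Q m)
    (mulVec_injective_iff_isUnit.2 ((isUnit_iff_isUnit_det _).2 (isUnit_det_Q m)))
  rwa [hQ] at h

theorem storage_pos (hP : ∀ m, (P m).PosDef) (hx : x ≠ 0) : 0 < storage P x := by
  have h1 : ∀ m, 0 ≤ x.1 m ⬝ᵥ ((G.Q m * P m * G.Q m) *ᵥ x.1 m) := fun m => by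
    simpa using (posDef_Q_mul_mul_Q m (hP m)).posSemidef.dotProduct_mulVec_nonneg (x.1 m)
  have h2 : ∀ l, 0 ≤ G.LT l * x.2 l ^ 2 := fun l => by
    have := G.LT_pos l
    positivity
  have h3 := Finset.sum_nonneg fun m (_ : m ∈ Finset.univ) => h1 m
  have h4 := Finset.sum_nonneg fun l (_ : l ∈ Finset.univ) => h2 l
  by_cases hm : ∃ m, x.1 m ≠ 0
  · obtain ⟨m, hm⟩ := hm
    have h5 : 0 < x.1 m ⬝ᵥ ((G.Q m * P m * G.Q m) *ᵥ x.1 m) := by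
      simpa using (posDef_Q_mul_mul_Q m (hP m)).dotProduct_mulVec_pos hm
    exact add_pos_of_pos_of_nonneg
      (Finset.sum_pos' (fun m _ => h1 m) ⟨m, Finset.mem_univ m, h5⟩) h4
  · push Not at hm
    obtain ⟨l, hl⟩ : ∃ l, x.2 l ≠ 0 := by
      by_contra! hl
      exact hx (Prod.ext (funext hm) (funext hl))
    have := G.LT_pos l
    exact add_pos_of_nonneg_of_pos h3
      (Finset.sum_pos' (fun l _ => h2 l) ⟨l, Finset.mem_univ l, by positivity⟩)

variable {e}

theorem hasDerivWithinAt_fst {x : ℝ → G.State} (hx : IsSolution e.field x) (m : Fin G.M)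
    (i : G.Idx m) (t : ℝ) (ht : 0 ≤ t) :
    HasDerivWithinAt (fun s => (x s).1 m i) ((e.field (x t)).1 m i) (Set.Ici 0) t :=
  hasDerivWithinAt_pi.1 (hasDerivWithinAt_pi.1 (hx t ht).fst m) i

theorem hasDerivWithinAt_storage (hP : ∀ m, (P m).PosDef) {x : ℝ → G.State}
    (hx : IsSolution e.field x) (t : ℝ) (ht : 0 ≤ t) :
    HasDerivWithinAt (fun s => storage P (x s)) (e.storageRate P (x t)) (Set.Ici 0) t := by
  refine HasDerivWithinAt.add (HasDerivWithinAt.fun_sum fun m _ => ?_)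
    (HasDerivWithinAt.fun_sum fun l _ => ?_)
  · have hS : (G.Q m * P m * G.Q m)ᵀ = G.Q m * P m * G.Q m :=
      (posDef_Q_mul_mul_Q m (hP m)).isHermitian
    refine (hasDerivWithinAt_dotProduct_mulVec hS
      (hasDerivWithinAt_pi.1 (hx t ht).fst m)).congr_deriv ?_
    have hf : (e.field (x t)).1 m
        = (G.Q m)⁻¹ *ᵥ (G.A m *ᵥ (x t).1 m + G.B m *ᵥ e.input m (x t)) := rfl
    -- The right factor of `Q P Q` cancels `Q⁻¹`, leaving the product `Q P` that occurs in the LMI.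
    rw [hf, mulVec_mulVec, mul_nonsing_inv_cancel_right _ _ (isUnit_det_Q m)]
  · have h := ((hasDerivWithinAt_pi.1 (hx t ht).snd l).fun_pow 2).const_mul (G.LT l)
    refine h.congr_deriv ?_
    have := (G.LT_pos l).ne'
    simp only [SteadyState.field]
    field_simp
    norm_num
    ring

variable (e)

/-- Power balance: each line feeds its current into its sink and takes it from its source, so
summing over buses regroups into a sum over lines. -/
theorem sum_mul_netT (y : ∀ m, G.Bus m → ℝ) (i : Fin G.nT → ℝ) :
    ∑ m, y m ⬝ᵥ G.netT i m
      = ∑ l, i l * (y (G.snkT l).1 (G.snkT l).2 - y (G.srcT l).1 (G.srcT l).2) := by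
  have h : ∀ bus : Fin G.nT → Σ m, G.Bus m,
      ∑ m, ∑ n, y m n * ∑ l, (if bus l = ⟨m, n⟩ then i l else 0)
        = ∑ l, i l * y (bus l).1 (bus l).2 := by
    intro bus
    rw [← Fintype.sum_sigma' (fun m n => y m n * ∑ l, (if bus l = ⟨m, n⟩ then i l else 0))]
    simp only [Finset.mul_sum]
    rw [Finset.sum_comm]
    refine Finset.sum_congr rfl fun l _ => ?_
    simp [mul_comm]
  simp only [dotProduct, netT, mul_sub, Finset.sum_sub_distrib, h]

/-- Passivity of the load: a monotone function vanishing at zero has the sign of its argument. -/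
theorem mul_shiftedLoad_nonneg (n : G.Bus m) (w : ℝ) : 0 ≤ w * e.shiftedLoad m n w := by
  have hmono := G.monotone_load_add m n
  rcases le_total 0 w with hw | hw
  · exact mul_nonneg hw (sub_nonneg.2 (hmono (by linarith)))
  · exact mul_nonneg_of_nonpos_of_nonpos hw (sub_nonpos.2 (hmono (by linarith)))

/-- Dissipation inequality of the interconnected microgrid. -/
theorem storageRate_le {ε : Fin G.M → ℝ}
    (hLMI : ∀ m, (-(G.Q m * P m * G.A m + (G.A m)ᵀ * P m * G.Q m
      + ε m • (G.B m * (G.B m)ᵀ))).PosSemidef)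
    (hP : ∀ m, (P m).PosDef) (hB : ∀ m, G.Q m * P m * G.B m = G.B m) :
    e.storageRate P x
      ≤ -(∑ m, ε m * (output m x ⬝ᵥ output m x) + ∑ l, 2 * G.RT l * x.2 l ^ 2) := by
  have hm : ∀ m, 2 * (x.1 m ⬝ᵥ ((G.Q m * P m) *ᵥ (G.A m *ᵥ x.1 m + G.B m *ᵥ e.input m x)))
      ≤ -(ε m * (output m x ⬝ᵥ output m x)) + 2 * (output m x ⬝ᵥ G.netT x.2 m) := by
    intro m
    -- Symmetry of `P` and `Q` puts the LMI in the form `N + Nᵀ`.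
    have hT : (G.A m)ᵀ * P m * G.Q m = (G.Q m * P m * G.A m)ᵀ := by
      have hPT : (P m)ᵀ = P m := (hP m).isHermitian
      rw [transpose_mul, transpose_mul, hPT, Q, diagonal_transpose, Matrix.mul_assoc]
    have h1 := two_mul_dotProduct_mulVec_le (hT ▸ hLMI m) (x.1 m)
    have h2 : x.1 m ⬝ᵥ (G.B m *ᵥ e.input m x) = output m x ⬝ᵥ e.input m x := by
      rw [dotProduct_mulVec, ← mulVec_transpose]
      rfl
    have h3 : output m x ⬝ᵥ e.input m x ≤ output m x ⬝ᵥ G.netT x.2 m := by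
      refine Finset.sum_le_sum fun n _ => ?_
      rw [SteadyState.input, mul_sub]
      linarith [mul_shiftedLoad_nonneg e m n (output m x n)]
    rw [mulVec_add, mulVec_mulVec, mulVec_mulVec, hB, dotProduct_add, h2]
    change _ ≤ -(ε m * (output m x ⬝ᵥ output m x)) at h1
    linarith
  have hsum := Finset.sum_le_sum fun m (_ : m ∈ Finset.univ) => hm m
  have hnet : ∑ m, 2 * (output m x ⬝ᵥ G.netT x.2 m) = 2 * ∑ l, x.2 l *
      (output (G.snkT l).1 x (G.snkT l).2 - output (G.srcT l).1 x (G.srcT l).2) := by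
    rw [← Finset.mul_sum, sum_mul_netT (fun m => output m x) x.2]
  rw [Finset.sum_add_distrib, Finset.sum_neg_distrib, hnet] at hsum
  -- The cross terms here are the negatives of those in `hnet`; only the resistive losses survive.
  have hline : ∑ l, 2 * x.2 l * (-G.RT l * x.2 l + output (G.srcT l).1 x (G.srcT l).2
      - output (G.snkT l).1 x (G.snkT l).2)
      = -∑ l, 2 * G.RT l * x.2 l ^ 2 - 2 * ∑ l, x.2 l * (output (G.snkT l).1 x (G.snkT l).2
        - output (G.srcT l).1 x (G.srcT l).2) := by
    rw [Finset.mul_sum, ← Finset.sum_neg_distrib, ← Finset.sum_sub_distrib]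
    exact Finset.sum_congr rfl fun l _ => by ring
  rw [SteadyState.storageRate, hline]
  linarith

/-! ### Convergence -/

variable {e}

/-- A bounded solution along which the bus voltages and the currents of the lines between the
clusters tend to zero tends to zero. -/
theorem tendsto_zero_of_output {x : ℝ → G.State} (hx : IsSolution e.field x) {ρ : ℝ}
    (hb : ∀ t, 0 ≤ t → ‖x t‖ ≤ ρ)
    (hy : ∀ m n, Tendsto (fun t => output m (x t) n) atTop (𝓝 0))
    (hT : Tendsto (fun t => (x t).2) atTop (𝓝 0)) : Tendsto x atTop (𝓝 0) := by
  obtain ⟨K, hK⟩ := e.exists_lipschitzWith_field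
  -- Barbalat for a single state: if it tends to zero, so does its derivative.
  have hbar : ∀ (m : Fin G.M) (i : G.Idx m), Tendsto (fun t => (x t).1 m i) atTop (𝓝 0) →
      Tendsto (fun t => (e.field (x t)).1 m i) atTop (𝓝 0) := fun m i =>
    hx.tendsto_deriv_zero hK.continuous hb (e.continuous_field_fst m i)
      (hasDerivWithinAt_fst hx m i)
  have hvS : ∀ m j, Tendsto (fun t => (x t).1 m (.vS j)) atTop (𝓝 0) := fun m j => by
    simpa only [output_inl] using hy m (.inl j)
  have hvF : ∀ m k, Tendsto (fun t => (x t).1 m (.vF k)) atTop (𝓝 0) := fun m k => by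
    simpa only [output_inr] using hy m (.inr k)
  have hlin : ∀ (m : Fin G.M) (i : G.Idx m) {a : ℝ} {w : ℝ → ℝ}, 0 < a →
      (∀ t, (e.field (x t)).1 m i = -a * (x t).1 m i + w t) → Tendsto w atTop (𝓝 0) →
      Tendsto (fun t => (x t).1 m i) atTop (𝓝 0) := fun m i a w ha h hw =>
    tendsto_zero_of_hasDerivWithinAt_linear ha
      (fun t ht => (hasDerivWithinAt_fst hx m i t ht).congr_deriv (h t)) hw
  have hiE : ∀ m l, Tendsto (fun t => (x t).1 m (.iE l)) atTop (𝓝 0) := fun m l => by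
    refine hlin m (.iE l) (div_pos (G.RE_pos m l) (G.LE_pos m l)) (fun t => field_iE e _ m l) ?_
    have h1 := tendsto_finsetSum Finset.univ fun j _ => (hvS m j).const_mul (G.E m (.inl j) l)
    have h2 := tendsto_finsetSum Finset.univ fun k _ => (hvF m k).const_mul (G.E m (.inr k) l)
    simpa using (h1.neg.sub h2).div_const (G.LE m l)
  have hzF : ∀ m k, Tendsto (fun t => (x t).1 m (.zF k)) atTop (𝓝 0) := fun m k => by
    refine hlin m (.zF k) (G.τ_pos m k) (fun t => field_zF e _ m k) ?_
    simpa using (hvF m k).const_mul (G.τ m k * G.α m k)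
  have hiaF : ∀ m k, Tendsto (fun t => (x t).1 m (.iaF k)) atTop (𝓝 0) := fun m k => by
    refine hlin m (.iaF k) (div_pos (add_pos (G.R_pos m _) (G.β_pos m k)) (G.L_pos m _))
      (fun t => field_iaF e _ m k) ?_
    simpa using ((hzF m k).sub ((hvF m k).const_mul (G.αMod m k))).div_const (G.L m (.inr k))
  have hu : ∀ m n, Tendsto (fun t => e.input m (x t) n) atTop (𝓝 0) := fun m n => by
    have hnet : Tendsto (fun t => G.netT (x t).2 m n) atTop (𝓝 0) := by
      have hc : Continuous fun i => G.netT i m n := by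
        unfold netT
        refine Continuous.sub ?_ ?_ <;> refine continuous_finsetSum _ fun l _ => ?_ <;>
          split_ifs <;> fun_prop
      have h0 : G.netT 0 m n = 0 := by simp [netT]
      exact h0 ▸ (hc.tendsto 0).comp hT
    have hload : Tendsto (fun t => e.shiftedLoad m n (output m (x t) n)) atTop (𝓝 0) := by
      obtain ⟨K, hK⟩ := G.load_lipschitz m n
      have hc : Continuous (e.shiftedLoad m n) := by
        have := hK.continuous
        unfold SteadyState.shiftedLoad monotoneLoad
        fun_prop
      have h0 : e.shiftedLoad m n 0 = 0 := by simp [SteadyState.shiftedLoad]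
      exact h0 ▸ (hc.tendsto 0).comp (hy m n)
    have h := hnet.sub hload
    rwa [sub_zero] at h
  -- The voltage equation is solved for the filter current; every other term, including the
  -- derivative, is known to vanish. The next step solves the current equation for the integrator in
  -- the same way.
  have hiaS : ∀ m j, Tendsto (fun t => (x t).1 m (.iaS j)) atTop (𝓝 0) := fun m j => by
    have h1 := hbar m (.vS j) (hvS m j)
    have h2 := tendsto_finsetSum Finset.univ fun l _ => (hiE m l).const_mul (G.E m (.inl j) l)
    have h3 := (h1.const_mul (G.Ceq m (.inl j))).sub
      ((((hvS m j).const_mul (G.Y m (.inl j) - G.δ m (.inl j))).add h2).add (hu m (.inl j)))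
    simpa [field_vS, mul_div_cancel₀, (Ceq_pos m (.inl j)).ne'] using h3
  have hzS : ∀ m j, Tendsto (fun t => (x t).1 m (.zS j)) atTop (𝓝 0) := fun m j => by
    have h1 := (hbar m (.iaS j) (hiaS m j)).const_mul (G.L m (.inl j))
    have h2 := (h1.add ((hiaS m j).const_mul (G.ψIMod m j))).add
      ((hvS m j).const_mul (G.ψVMod m j))
    have h3 : ∀ t, G.L m (.inl j) * (e.field (x t)).1 m (.iaS j)
        + G.ψIMod m j * (x t).1 m (.iaS j) + G.ψVMod m j * (x t).1 m (.vS j)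
        = -(x t).1 m (.zS j) := fun t => by
      rw [field_iaS, mul_div_cancel₀ _ (G.L_pos m (.inl j)).ne']
      ring
    simp only [h3] at h2
    simpa using h2.neg
  refine Tendsto.prodMk_nhds (tendsto_pi_nhds.2 fun m => tendsto_pi_nhds.2 fun i => ?_) hT
  cases i
  exacts [hzS m _, hiaS m _, hvS m _, hzF m _, hiaF m _, hvF m _, hiE m _]

/-- Dissipation forces the bus voltages and the currents of the lines between the clusters to tend
to zero. -/
theorem tendsto_zero_of_dissipation {ε : Fin G.M → ℝ} (hε : ∀ m, 0 < ε m) {x : ℝ → G.State}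
    {w : ℝ → ℝ} (hw : Tendsto w atTop (𝓝 0))
    (hle : ∀ t, w t ≤ -(∑ m, ε m * (output m (x t) ⬝ᵥ output m (x t))
      + ∑ l, 2 * G.RT l * (x t).2 l ^ 2)) :
    (∀ m n, Tendsto (fun t => output m (x t) n) atTop (𝓝 0)) ∧
      Tendsto (fun t => (x t).2) atTop (𝓝 0) := by
  -- Every summand of the dissipation is nonnegative, so each square alone is squeezed by `-w`.
  have key : ∀ {φ : ℝ → ℝ} {c : ℝ}, 0 < c → (∀ t, c * φ t ^ 2 ≤ -w t) →
      Tendsto φ atTop (𝓝 0) := by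
    intro φ c hc h
    have h1 : Tendsto (fun t => φ t ^ 2) atTop (𝓝 0) := by
      refine squeeze_zero (fun t => sq_nonneg _) (fun t => (le_div_iff₀' hc).2 (h t)) ?_
      simpa using hw.neg.div_const c
    have h2 := h1.sqrt
    simp only [Real.sqrt_sq_eq_abs, Real.sqrt_zero] at h2
    exact (tendsto_zero_iff_abs_tendsto_zero φ).2 h2
  have hyy : ∀ t m, 0 ≤ ε m * (output m (x t) ⬝ᵥ output m (x t)) := fun t m =>
    mul_nonneg (hε m).le (Finset.sum_nonneg fun _ _ => mul_self_nonneg _)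
  have hll : ∀ t l, 0 ≤ 2 * G.RT l * (x t).2 l ^ 2 := fun t l => by
    have := G.RT_pos l
    positivity
  refine ⟨fun m n => key (hε m) fun t => ?_, tendsto_pi_nhds.2 fun l =>
    key (mul_pos two_pos (G.RT_pos l)) fun t => ?_⟩
  · have h1 : output m (x t) n ^ 2 ≤ output m (x t) ⬝ᵥ output m (x t) := by
      rw [sq]
      exact Finset.single_le_sum (f := fun n => output m (x t) n * output m (x t) n)
        (fun _ _ => mul_self_nonneg _) (Finset.mem_univ n)
    have h2 := Finset.single_le_sum (fun m _ => hyy t m) (Finset.mem_univ m)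
    have h3 := Finset.sum_nonneg fun l (_ : l ∈ Finset.univ) => hll t l
    have h4 := mul_le_mul_of_nonneg_left h1 (hε m).le
    linarith [hle t]
  · have h2 := Finset.single_le_sum (fun l _ => hll t l) (Finset.mem_univ l)
    have h3 := Finset.sum_nonneg fun m (_ : m ∈ Finset.univ) => hyy t m
    linarith [hle t]

end Microgrid

/-- Clustered microgrid stability. -/
theorem mainTheorem1 (G : Microgrid) (e : G.SteadyState) (he : e.IsEquilibrium)
    (hLMI : ∀ m, G.LMI m) :
    (∀ m, e.input m 0 = 0) ∧ IsAsymptoticallyStable e.field 0 := by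
  refine ⟨e.input_zero, ?_⟩
  choose P hP ε hε hsemi hB using hLMI
  have hdiss := fun x => Microgrid.storageRate_le e x hsemi hP hB
  obtain ⟨K, hK⟩ := e.exists_lipschitzWith_field
  refine isAsymptoticallyStable_zero_of_lyapunov hK e.field_zero (Microgrid.continuous_storage P)
    (fun r x => Microgrid.storage_smul x P r) (fun x hx => Microgrid.storage_pos x hP hx)
    (fun x hx => Microgrid.hasDerivWithinAt_storage hP hx) (e.continuous_storageRate P)
    (fun x => (hdiss x).trans ?_) (fun x ρ hx hb hlim => ?_)
  · refine neg_nonpos.2 (add_nonneg (Finset.sum_nonneg fun m _ => mul_nonneg (hε m).le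
      (Finset.sum_nonneg fun _ _ => mul_self_nonneg _)) (Finset.sum_nonneg fun l _ => ?_))
    have := G.RT_pos l
    positivity
  · obtain ⟨hy, hT⟩ := Microgrid.tendsto_zero_of_dissipation hε hlim fun t => hdiss (x t)
    exact Microgrid.tendsto_zero_of_output hx hb hy hT
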